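/- Let $d \ge 2$. A \emph{$d$-pseudomanifold} is a finite regular CW complex that is simplicial (every closed cell is a simplex, whose faces are cells; different cells may have the same vertices), pure $d$-dimensional, and such that every $(d-1)$-cell belongs to at most two $d$-cells. Its \emph{boundary facets} are the $(d-1)$-cells that belong to exactly one $d$-cell. A \emph{tree of $d$-simplices} is a simplicial complex homeomorphic to the unit ball of $\mathbb{R}^d$ (a $d$-ball) whose dual graph, formed by the $d$-simplices with adjacency meaning a common $(d-1)$-face, is a tree. A \emph{Mogami gluing} passes from a $d$-pseudomanifold $P$ to a $d$-pseudomanifold $Q$ by identifying, via an affine isomorphism that matches their vertices, two distinct boundary facets of $P$ whose intersection is nonempty. A $d$-pseudomanifold is \emph{Mogami} if it can be obtained from a tree of $d$-simplices by a finite, possibly empty, sequence of Mogami gluings; neither it nor the intermediate pseudomanifolds need be simplicial complexes. Then every Mogami $d$-pseudomanifold is simply connected (that is, its underlying space is path-connected with trivial fundamental group). -/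

import Mathlib

universe u

/-- A finite regular CW complex that is simplicial: a Hausdorff space partitioned into finitely
many open cells.  Every cell `c` has an injective continuous characteristic map `χ c` from the
closed standard simplex of dimension `dim c` (whose vertices are indexed by `Fin (dim c + 1)`),
and the restriction of `χ c` to each nonempty face of the simplex is, up to a relabelling of the
vertices, the characteristic map of a cell.  Distinct cells may have the same vertices, so this
need not be a simplicial complex. -/
structure SimplicialCW where
  /-- The underlying space. -/
  carrier : Type u
  [top : TopologicalSpace carrier]
  [t2 : T2Space carrier]
  /-- The index set of the cells. -/
  Cell : Type
  [finite : Finite Cell]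
  dim : Cell → ℕ
  χ : (c : Cell) → stdSimplex ℝ (Fin (dim c + 1)) → carrier
  continuous_χ : ∀ c, Continuous (χ c)
  injective_χ : ∀ c, Function.Injective (χ c)
  /-- Every point lies in exactly one open cell. -/
  existsUnique_cell : ∀ x : carrier, ∃! c : Cell, x ∈ χ c '' {t | ∀ i, 0 < t i}
  /-- The faces of a cell are cells. -/
  exists_face : ∀ (c : Cell) (S : Set (Fin (dim c + 1))), S.Nonempty →
    ∃ (b : Cell) (f : Fin (dim b + 1) → Fin (dim c + 1)), Function.Injective f ∧
      Set.range f = S ∧ ∀ t, χ b t = χ c (stdSimplex.map f t)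

namespace SimplicialCW

attribute [instance] SimplicialCW.top SimplicialCW.t2 SimplicialCW.finite

variable (K : SimplicialCW.{u})

/-- The closed cell of `c`, as a subset of the underlying space. -/
def closedCell (c : K.Cell) : Set K.carrier := Set.range (K.χ c)

/-- `K.IsFace b c`: the closed cell `b` is contained in the closed cell `c`, i.e. `b` belongs
to `c`. -/
def IsFace (b c : K.Cell) : Prop := K.closedCell b ⊆ K.closedCell c

/-- The `d`-dimensional cells that contain the cell `b`. -/
def cofaces (d : ℕ) (b : K.Cell) : Set K.Cell := {c | K.dim c = d ∧ K.IsFace b c}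

/-- `K` is a simplicial complex: any two closed cells are disjoint or meet in one closed cell
(a common face of both). -/
def IsSimplicialComplex : Prop :=
  ∀ a b : K.Cell, (K.closedCell a ∩ K.closedCell b).Nonempty →
    ∃ c : K.Cell, K.closedCell c = K.closedCell a ∩ K.closedCell b

end SimplicialCW

/-- A `d`-pseudomanifold: a finite regular simplicial CW complex that is pure `d`-dimensional and
in which every `(d-1)`-cell belongs to at most two `d`-cells.  It may be disconnected. -/
structure Pseudomanifold (d : ℕ) extends SimplicialCW.{u} where
  pure : ∀ b : Cell, ∃ c : Cell, dim c = d ∧ toSimplicialCW.IsFace b c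
  ncard_cofaces_le : ∀ b : Cell, dim b + 1 = d → (toSimplicialCW.cofaces d b).ncard ≤ 2

namespace Pseudomanifold

variable {d : ℕ}

/-- The boundary facets: the `(d-1)`-cells that belong to exactly one `d`-cell.  (The boundary is
the smallest subcomplex that contains them.) -/
def IsBoundaryFacet (P : Pseudomanifold.{u} d) (b : P.Cell) : Prop :=
  P.dim b + 1 = d ∧ (P.cofaces d b).ncard = 1

/-- The dual graph: its vertices are the `d`-cells, two of which are adjacent if they share
a `(d-1)`-cell. -/
def dualGraph (P : Pseudomanifold.{u} d) : SimpleGraph {c : P.Cell // P.dim c = d} where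
  Adj a b := a ≠ b ∧ ∃ e : P.Cell, P.dim e + 1 = d ∧ P.IsFace e a ∧ P.IsFace e b
  symm := ⟨fun _ _ h => ⟨h.1.symm, h.2.imp fun _ he => ⟨he.1, he.2.2, he.2.1⟩⟩⟩
  loopless := ⟨fun _ h => h.1 rfl⟩

/-- A `d`-ball: a simplicial complex that is homeomorphic to the unit ball of `ℝ^d`. -/
def IsBall (P : Pseudomanifold.{u} d) : Prop :=
  P.IsSimplicialComplex ∧
    Nonempty (P.carrier ≃ₜ Metric.closedBall (0 : EuclideanSpace ℝ (Fin d)) 1)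

/-- A tree of `d`-simplices: a `d`-ball whose dual graph is a tree. -/
def IsTreeOfSimplices (P : Pseudomanifold.{u} d) : Prop :=
  P.IsBall ∧ P.dualGraph.IsTree

/-- `P.IsGluing a b Q`: the pseudomanifold `Q` is obtained from `P` by identifying the cell `a`
with the cell `b`.  That is, there are a bijection `g` from the vertices of `a` to those of `b`
and a topological quotient map `q` from `P` to `Q` such that
* `q` identifies each point of `a` with the corresponding point of `b` (under the affine extension
  of `g`), and makes no identifications beyond those that these generate;
* up to a relabelling of vertices, the composition of `q` with the characteristic map of a cell of
  `P` is the characteristic map of a cell of `Q`.  (As `q` is onto and the open cells partition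
  `Q`, every cell of `Q` arises so.) -/
def IsGluing (P : Pseudomanifold.{u} d) (a b : P.Cell) (Q : Pseudomanifold.{u} d) : Prop :=
  ∃ (g : Fin (P.dim a + 1) ≃ Fin (P.dim b + 1)) (q : P.carrier → Q.carrier),
    Topology.IsQuotientMap q ∧
    (∀ x y, q x = q y ↔ Relation.EqvGen
      (fun x y => ∃ t, x = P.χ a t ∧ y = P.χ b (stdSimplex.map g t)) x y) ∧
    ∀ c : P.Cell, ∃ (c' : Q.Cell) (e : Fin (P.dim c + 1) ≃ Fin (Q.dim c' + 1)),
      ∀ t, q (P.χ c t) = Q.χ c' (stdSimplex.map e t)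

/-- `Q` is obtained from `P` by a Mogami gluing: the identification of two boundary facets of `P`
whose intersection is nonempty. -/
def MogamiGluing (P Q : Pseudomanifold.{u} d) : Prop :=
  ∃ a b : P.Cell, a ≠ b ∧ P.IsBoundaryFacet a ∧ P.IsBoundaryFacet b ∧
    (P.closedCell a ∩ P.closedCell b).Nonempty ∧ P.IsGluing a b Q

/-- A Mogami `d`-pseudomanifold: one that is obtained from a tree of `d`-simplices by a finite,
possibly empty, sequence of Mogami gluings.  It may be a simplicial complex (a Mogami complex in
the strict sense), but the intermediate pseudomanifolds of such a sequence are allowed too. -/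
def IsMogami (M : Pseudomanifold.{u} d) : Prop :=
  ∃ T : Pseudomanifold.{u} d, T.IsTreeOfSimplices ∧ Relation.ReflTransGen MogamiGluing T M

end Pseudomanifold

/-! A tree of simplices is a ball, hence contractible, so it suffices that gluing two cells `a`, `b`
with a common point `v` preserves simple connectedness. The quotient map `q` is injective on every
closed cell. The partner of `v` in `b` has the same image as `v`, which also lies in `b`, so the
gluing fixes `v`. Two matched points `x`, `y` are therefore joined by a path in `a` from `x` to `v`
and the reverse of its mirror image in `b`; its image under `q` runs out and back, so it is
null-homotopic. Since `P` is simply connected, every path between points of one fibre has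
null-homotopic image (`fiberPathsNull_of_eqvGen`).

Hence the image of a path in `P` depends, up to homotopy, only on the images of its endpoints.
Conversely, a path in `Q` is homotopic to a concatenation of paths in closed cells
(`path_induction`), and each of these lifts to a cell of `P`. So any two paths in `Q` with the same
endpoints are homotopic to the image of one path in `P`. -/

/-! ### Faces of the standard simplex and segments to its vertices. -/

namespace stdSimplex

variable {X Y : Type*} [Fintype X] [Fintype Y]

theorem map_apply_of_injective {f : X → Y} (hf : Function.Injective f) (t : stdSimplex ℝ X)
    (i : X) : map f t (f i) = t i := by
  classical
  rw [map_coe, FunOnFinite.linearMap_apply_apply, Finset.sum_eq_single i]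
  · intro j hj hji
    exact absurd (hf (Finset.mem_filter.1 hj).2) hji
  · intro h
    simp at h

theorem map_apply_of_notMem_range {f : X → Y} (t : stdSimplex ℝ X) {y : Y}
    (hy : y ∉ Set.range f) : map f t y = 0 := by
  classical
  rw [map_coe, FunOnFinite.linearMap_apply_apply, Finset.sum_eq_zero]
  intro j hj
  exact absurd ⟨j, (Finset.mem_filter.1 hj).2⟩ hy

theorem map_injective {f : X → Y} (hf : Function.Injective f) :
    Function.Injective (map (S := ℝ) f) := by
  intro s t h
  ext i
  rw [← map_apply_of_injective hf s, h, map_apply_of_injective hf]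

theorem exists_pos (t : stdSimplex ℝ X) : ∃ i, 0 < t i := by
  by_contra! h
  have h1 := sum_eq_one t
  rw [Finset.sum_eq_zero fun i _ => le_antisymm (h i) (zero_le t i)] at h1
  exact zero_ne_one h1

/-- A point of the simplex comes from a point with positive coordinates on the face that its
support spans. -/
theorem exists_map_eq {f : X → Y} (hf : Function.Injective f) (t : stdSimplex ℝ Y)
    (hr : Set.range f = {y | 0 < t y}) :
    ∃ r : stdSimplex ℝ X, (∀ i, 0 < r i) ∧ map f r = t := by
  have hpos : ∀ i, 0 < t (f i) := fun i => by
    have : f i ∈ Set.range f := ⟨i, rfl⟩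
    rwa [hr] at this
  have hzero : ∀ y, y ∉ Set.range f → t y = 0 := fun y hy => by
    rw [hr] at hy
    exact le_antisymm (not_lt.1 hy) (zero_le t y)
  have hsum : ∑ i, t (f i) = 1 := by
    rw [← sum_eq_one t]
    exact Fintype.sum_of_injective f hf _ _ hzero fun i => rfl
  let r : stdSimplex ℝ X := ⟨fun i => t (f i), fun i => (hpos i).le, hsum⟩
  refine ⟨r, hpos, ?_⟩
  ext y
  by_cases hy : y ∈ Set.range f
  · obtain ⟨i, rfl⟩ := hy
    rw [map_apply_of_injective hf]
    rfl
  · rw [map_apply_of_notMem_range _ hy, hzero y hy]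

variable [DecidableEq X] [DecidableEq Y]

/-- The point at time `s` on the segment from `t` to the vertex `i`. -/
noncomputable def lineTo (i : X) (s : unitInterval) (t : stdSimplex ℝ X) : stdSimplex ℝ X :=
  ⟨(1 - (s : ℝ)) • t.1 + (s : ℝ) • (vertex (S := ℝ) i).1,
    convex_stdSimplex ℝ X t.2 (vertex i).2 (sub_nonneg.2 s.2.2) s.2.1 (sub_add_cancel _ _)⟩

theorem coe_lineTo (i : X) (s : unitInterval) (t : stdSimplex ℝ X) :
    ⇑(lineTo i s t) = (1 - (s : ℝ)) • ⇑t + (s : ℝ) • ⇑(vertex (S := ℝ) i) := rfl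

theorem lineTo_zero (i : X) (t : stdSimplex ℝ X) : lineTo i 0 t = t := by
  ext j
  simp [coe_lineTo]

theorem lineTo_one (i : X) (t : stdSimplex ℝ X) : lineTo i 1 t = vertex i := by
  ext j
  simp [coe_lineTo]

theorem map_lineTo (f : X → Y) (i : X) (s : unitInterval) (t : stdSimplex ℝ X) :
    map f (lineTo i s t) = lineTo (f i) s (map f t) := by
  ext j
  rw [coe_lineTo, ← map_vertex, map_coe, map_coe, map_coe, coe_lineTo, map_add, map_smul, map_smul]

theorem lineTo_apply_pos {i : X} {t : stdSimplex ℝ X} (h : 0 < t i) (s : unitInterval) :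
    0 < lineTo i s t i := by
  have h0 := s.2.1
  have h2 := s.2.2
  simp only [coe_lineTo, Pi.add_apply, Pi.smul_apply, vertex_coe, Pi.single_eq_same, smul_eq_mul]
  rcases h0.eq_or_lt with h3 | h3
  · rw [← h3]; simpa using h
  · nlinarith [mul_nonneg (sub_nonneg.2 h2) h.le]

theorem continuous_lineTo (i : X) :
    Continuous fun p : unitInterval × stdSimplex ℝ X => lineTo i p.1 p.2 := by
  refine Continuous.subtype_mk ?_ _
  fun_prop

/-- The segment from a point of a simplex to a vertex. -/
noncomputable def linePath (i : X)
    (t : stdSimplex ℝ X) : Path t (vertex i) where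
  toFun s := lineTo i s t
  continuous_toFun := (continuous_lineTo i).comp (continuous_id.prodMk continuous_const)
  source' := lineTo_zero i t
  target' := lineTo_one i t

theorem linePath_apply (i : X) (t : stdSimplex ℝ X) (s : unitInterval) :
    linePath i t s = lineTo i s t := rfl

end stdSimplex

/-! ### Intersections of closed cells. -/

namespace SimplicialCW

open stdSimplex

variable (K : SimplicialCW.{u})

theorem exists_open_cell (x : K.carrier) :
    ∃ (c : K.Cell) (t : stdSimplex ℝ (Fin (K.dim c + 1))), (∀ i, 0 < t i) ∧ K.χ c t = x := by
  obtain ⟨c, ⟨t, ht, h⟩, -⟩ := K.existsUnique_cell x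
  exact ⟨c, t, ht, h⟩

variable {K}

theorem eq_of_open_cell {c c' : K.Cell} {t : stdSimplex ℝ (Fin (K.dim c + 1))}
    {t' : stdSimplex ℝ (Fin (K.dim c' + 1))} (ht : ∀ i, 0 < t i) (ht' : ∀ i, 0 < t' i)
    (h : K.χ c t = K.χ c' t') : c = c' :=
  (K.existsUnique_cell (K.χ c t)).unique ⟨t, ht, rfl⟩ ⟨t', ht', h.symm⟩

/-- A common point of two closed cells lies in the interior of a common face. -/
theorem exists_common_face {c c' : K.Cell} {t : stdSimplex ℝ (Fin (K.dim c + 1))}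
    {t' : stdSimplex ℝ (Fin (K.dim c' + 1))} (h : K.χ c t = K.χ c' t') :
    ∃ (a : K.Cell) (f : Fin (K.dim a + 1) → Fin (K.dim c + 1))
      (g : Fin (K.dim a + 1) → Fin (K.dim c' + 1)) (r : stdSimplex ℝ (Fin (K.dim a + 1))),
      Function.Injective f ∧ Function.Injective g ∧ (∀ j, 0 < r j) ∧
      map f r = t ∧ map g r = t' ∧ Set.range g = {i | 0 < t' i} ∧
      (∀ s, K.χ a s = K.χ c (map f s)) ∧ ∀ s, K.χ a s = K.χ c' (map g s) := by
  obtain ⟨a, f, hf, hfr, hfχ⟩ := K.exists_face c {i | 0 < t i} (exists_pos t)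
  obtain ⟨a', g, hg, hgr, hgχ⟩ := K.exists_face c' {i | 0 < t' i} (exists_pos t')
  obtain ⟨r, hr, hrt⟩ := exists_map_eq hf t hfr
  obtain ⟨r', hr', hrt'⟩ := exists_map_eq hg t' hgr
  -- The faces spanned by the two supports both contain the point in their interiors, so they are
  -- one cell.
  have hχ : K.χ a r = K.χ a' r' := by rw [hfχ, hgχ, hrt, hrt', h]
  obtain rfl := eq_of_open_cell hr hr' hχ
  obtain rfl := K.injective_χ a hχ
  exact ⟨a, f, g, r, hf, hg, hr, hrt, hrt', hgr, hfχ, hgχ⟩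

/-- If two closed cells share a point, then a vertex of one cell with positive coordinate there
is also a vertex of the other, with positive coordinate. -/
theorem exists_vertex_eq {c c' : K.Cell} {t : stdSimplex ℝ (Fin (K.dim c + 1))}
    {t' : stdSimplex ℝ (Fin (K.dim c' + 1))} (h : K.χ c t = K.χ c' t')
    {i' : Fin (K.dim c' + 1)} (hi' : 0 < t' i') :
    ∃ i, 0 < t i ∧ K.χ c (vertex i) = K.χ c' (vertex i') ∧
      ∀ s, K.χ c (lineTo i s t) = K.χ c' (lineTo i' s t') := by
  obtain ⟨a, f, g, r, hf, hg, hr, rfl, rfl, hgr, hfχ, hgχ⟩ := exists_common_face h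
  obtain ⟨j, rfl⟩ : i' ∈ Set.range g := by rw [hgr]; exact hi'
  refine ⟨f j, ?_, ?_, fun s => ?_⟩
  · rw [map_apply_of_injective hf]
    exact hr j
  · rw [← map_vertex f, ← map_vertex g, ← hfχ, hgχ]
  · rw [← map_lineTo, ← map_lineTo, ← hfχ, hgχ]

/-- Makes the contraction of a star independent of the cell used to describe a point: within `c`, a
vertex is determined by its image. -/
theorem lineTo_eq_lineTo {c c' : K.Cell} {t : stdSimplex ℝ (Fin (K.dim c + 1))}
    {t' : stdSimplex ℝ (Fin (K.dim c' + 1))} (h : K.χ c t = K.χ c' t')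
    {i : Fin (K.dim c + 1)} {i' : Fin (K.dim c' + 1)} (hi' : 0 < t' i')
    (hv : K.χ c (vertex i) = K.χ c' (vertex i')) (s : unitInterval) :
    K.χ c (lineTo i s t) = K.χ c' (lineTo i' s t') := by
  obtain ⟨k, -, hk, hl⟩ := exists_vertex_eq h hi'
  obtain rfl := vertex_injective (K.injective_χ c (hk.trans hv.symm))
  exact hl s

/-! ### Open vertex stars and decomposition of paths. -/

variable (K) in
/-- The open star of the vertex `w`. -/
def star (w : K.carrier) : Set K.carrier :=
  {x | ∃ (c : K.Cell) (t : stdSimplex ℝ (Fin (K.dim c + 1))) (i : Fin (K.dim c + 1)),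
    K.χ c t = x ∧ 0 < t i ∧ K.χ c (vertex i) = w}

theorem isClosedEmbedding_χ (c : K.Cell) : Topology.IsClosedEmbedding (K.χ c) :=
  (K.continuous_χ c).isClosedEmbedding (K.injective_χ c)

/-- The complement is a finite union of compact pieces, one in each closed cell: the points whose
coordinate at `w` vanishes, or the whole cell if `w` is not a vertex of it. -/
theorem isOpen_star (w : K.carrier) : IsOpen (K.star w) := by
  have : (K.star w)ᶜ = ⋃ c : K.Cell,
      K.χ c '' {t | ∀ i, K.χ c (vertex i) = w → t i = 0} := by
    ext x
    simp only [Set.mem_compl_iff, Set.mem_iUnion, Set.mem_image, Set.mem_ofPred_eq]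
    constructor
    · intro hx
      obtain ⟨c, t, -, rfl⟩ := K.exists_open_cell x
      refine ⟨c, t, fun i hi => ?_, rfl⟩
      by_contra h0
      exact hx ⟨c, t, i, rfl, lt_of_le_of_ne (zero_le t i) (Ne.symm h0), hi⟩
    · rintro ⟨c, t, ht, rfl⟩ ⟨c', t', i', h, hi', hw⟩
      obtain ⟨i, hi, hv, -⟩ := exists_vertex_eq h.symm hi'
      exact hi.ne' (ht i (hv.trans hw))
  rw [← isClosed_compl_iff, this]
  refine isClosed_iUnion_of_finite fun c => (isClosedEmbedding_χ c).isClosedMap _ ?_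
  simp only [Set.ofPred_forall]
  refine isClosed_iInter fun i => isClosed_iInter fun _ => isClosed_eq ?_ continuous_const
  exact (continuous_apply i).comp continuous_subtype_val

theorem exists_mem_star (x : K.carrier) : ∃ w, x ∈ K.star w := by
  obtain ⟨c, t, ht, rfl⟩ := K.exists_open_cell x
  exact ⟨_, c, t, 0, rfl, ht 0, rfl⟩

theorem lineTo_mem_star {c : K.Cell} {t : stdSimplex ℝ (Fin (K.dim c + 1))}
    {i : Fin (K.dim c + 1)} (h : 0 < t i) (s : unitInterval) :
    K.χ c (lineTo i s t) ∈ K.star (K.χ c (vertex i)) :=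
  ⟨c, _, i, rfl, lineTo_apply_pos h s, rfl⟩

/-- The linear contraction of an open star to its centre. -/
noncomputable def starContraction (w : K.carrier) (p : unitInterval × K.star w) : K.star w :=
  ⟨K.χ p.2.2.choose (lineTo p.2.2.choose_spec.choose_spec.choose p.1
      p.2.2.choose_spec.choose), by
    obtain ⟨-, h1, h2⟩ := p.2.2.choose_spec.choose_spec.choose_spec
    have := lineTo_mem_star h1 p.1
    rwa [h2] at this⟩

theorem coe_starContraction {w : K.carrier} (s : unitInterval) (x : K.star w) {c : K.Cell}
    {t : stdSimplex ℝ (Fin (K.dim c + 1))} {i : Fin (K.dim c + 1)} (h : K.χ c t = x)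
    (hi : 0 < t i) (hw : K.χ c (vertex i) = w) :
    (starContraction w (s, x) : K.carrier) = K.χ c (lineTo i s t) := by
  obtain ⟨h0, -, h2⟩ := x.2.choose_spec.choose_spec.choose_spec
  exact lineTo_eq_lineTo (h0.trans h.symm) hi (h2.trans hw.symm) s

/-- Continuity is checked on the finite closed cover by closed cells. On a cell with vertex `w` the
map is a straight-line contraction; a cell without vertex `w` misses the star. -/
theorem continuous_starContraction (w : K.carrier) :
    Continuous (starContraction (K := K) w) := by
  rw [Topology.IsInducing.subtypeVal.continuous_iff]
  refine (locallyFinite_of_finite fun c : K.Cell =>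
    {p : unitInterval × K.star w | (p.2 : K.carrier) ∈ Set.range (K.χ c)}).continuous ?_ ?_ ?_
  · refine Set.eq_univ_of_forall fun p => Set.mem_iUnion.2 ?_
    obtain ⟨c, t, -, h⟩ := K.exists_open_cell p.2
    exact ⟨c, t, h⟩
  · intro c
    exact (isClosedEmbedding_χ c).isClosed_range.preimage
      (continuous_subtype_val.comp continuous_snd)
  · intro c
    rw [continuousOn_iff_continuous_domRestrict]
    by_cases hc : ∃ i, K.χ c (vertex i) = w
    · obtain ⟨i, hi⟩ := hc
      let e := (isClosedEmbedding_χ c).isEmbedding.toHomeomorph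
      have key : ({p : unitInterval × K.star w |
            (p.2 : K.carrier) ∈ Set.range (K.χ c)}.domRestrict
              (Subtype.val ∘ starContraction (K := K) w)) =
          fun p => K.χ c (lineTo i p.1.1 (e.symm ⟨p.1.2, p.2⟩)) := by
        funext p
        have hx : K.χ c (e.symm ⟨p.1.2, p.2⟩) = p.1.2 :=
          congrArg Subtype.val (e.apply_symm_apply ⟨p.1.2, p.2⟩)
        obtain ⟨c', t', i', h, hi', hw⟩ := p.1.2.2
        obtain ⟨k, hk, hv, -⟩ := exists_vertex_eq (hx.trans h.symm) hi'
        obtain rfl := vertex_injective (K.injective_χ c ((hv.trans hw).trans hi.symm))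
        exact coe_starContraction p.1.1 p.1.2 hx hk hi
      rw [key]
      refine (K.continuous_χ c).comp ((continuous_lineTo i).comp (Continuous.prodMk ?_ ?_))
      · fun_prop
      · exact e.symm.continuous.comp (Continuous.subtype_mk (by fun_prop) _)
    · have : IsEmpty {p : unitInterval × K.star w |
          (p.2 : K.carrier) ∈ Set.range (K.χ c)} := by
        refine ⟨?_⟩
        rintro ⟨⟨s, x, c', t', i', h, hi', hw⟩, t, ht⟩
        obtain ⟨k, -, hv, -⟩ := exists_vertex_eq (ht.trans h.symm) hi'
        exact hc ⟨k, hv.trans hw⟩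
      exact continuous_of_const fun x => isEmptyElim x

theorem contractibleSpace_star {w : K.carrier} (hw : (K.star w).Nonempty) :
    ContractibleSpace (K.star w) := by
  have hmem : w ∈ K.star w := by
    obtain ⟨x, c, t, i, rfl, hi, rfl⟩ := hw
    exact ⟨c, vertex i, i, rfl, by simp, rfl⟩
  rw [contractible_iff_id_nullhomotopic]
  refine ⟨⟨w, hmem⟩, ⟨⟨⟨starContraction w, continuous_starContraction w⟩, ?_, ?_⟩⟩⟩
  · intro x
    obtain ⟨c, t, i, h, hi, hv⟩ := x.2
    refine Subtype.ext ((coe_starContraction 0 x h hi hv).trans ?_)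
    rw [lineTo_zero, h]
    rfl
  · intro x
    obtain ⟨c, t, i, h, hi, hv⟩ := x.2
    refine Subtype.ext ((coe_starContraction 1 x h hi hv).trans ?_)
    rw [lineTo_one, hv]
    rfl

/-- Every path in a simplicial CW complex is homotopic to a concatenation of paths in closed
cells, stated as an induction principle. -/
theorem path_induction {G : ∀ {x y : K.carrier}, Path x y → Prop}
    (homotopic : ∀ {x y} {γ γ' : Path x y}, γ.Homotopic γ' → G γ → G γ')
    (trans : ∀ {x y z} (γ : Path x y) (γ' : Path y z), G γ → G γ' → G (γ.trans γ'))
    (cell : ∀ (c : K.Cell) {t u : stdSimplex ℝ (Fin (K.dim c + 1))} (τ : Path t u),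
      G (τ.map (K.continuous_χ c))) {x y : K.carrier} (γ : Path x y) : G γ := by
  have cast : ∀ {x y x' y' : K.carrier} (hx : x' = x) (hy : y' = y) (γ : Path x y),
      G (γ.cast hx hy) → G γ := by
    rintro x y _ _ rfl rfl γ h
    exact h
  have star : ∀ (w : K.carrier) {x y : K.carrier} (γ : Path x y),
      (∀ s, γ s ∈ K.star w) → G γ := by
    intro w x y γ hγ
    have hx : x ∈ K.star w := by simpa using hγ 0
    have hy : y ∈ K.star w := by simpa using hγ 1
    have := contractibleSpace_star ⟨x, hx⟩
    have hx' := hx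
    have hy' := hy
    obtain ⟨c, t, i, rfl, hi, rfl⟩ := hx
    obtain ⟨c', t', i', rfl, hi', hv⟩ := hy
    let α : Path (⟨_, hx'⟩ : K.star (K.χ c (vertex i))) ⟨_, hy'⟩ :=
      ⟨⟨fun s => ⟨γ s, hγ s⟩, by fun_prop⟩, by simp, by simp⟩
    have hw : K.χ c (vertex i) ∈ K.star (K.χ c (vertex i)) := ⟨c, vertex i, i, rfl, by simp, rfl⟩
    let β : Path (⟨_, hx'⟩ : K.star (K.χ c (vertex i))) ⟨_, hw⟩ :=
      ⟨⟨fun s => ⟨K.χ c (linePath i t s), by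
          rw [linePath_apply]
          exact lineTo_mem_star hi s⟩,
        Continuous.subtype_mk ((K.continuous_χ c).comp (map_continuous _)) fun s => lineTo_mem_star hi s⟩,
        by simp, by simp⟩
    let β' : Path (⟨_, hy'⟩ : K.star (K.χ c (vertex i))) ⟨_, hw⟩ :=
      ⟨⟨fun s => ⟨K.χ c' (linePath i' t' s), by
          rw [linePath_apply, ← hv]
          exact lineTo_mem_star hi' s⟩,
        Continuous.subtype_mk ((K.continuous_χ c').comp (map_continuous _)) fun s => by
          rw [Function.comp_apply, linePath_apply, ← hv]
          exact lineTo_mem_star hi' s⟩,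
        by simp, by simp [hv]⟩
    -- The star is contractible, so `γ` may be replaced by two segments through its centre, each
    -- inside one closed cell.
    have h := (SimplyConnectedSpace.paths_homotopic (β.trans β'.symm) α).map
      ⟨Subtype.val, continuous_subtype_val⟩
    refine homotopic h ?_
    rw [Path.map_trans]
    refine trans _ _ (cell c (linePath i t)) ?_
    refine cast (x' := K.χ c' (vertex i')) hv rfl _ ?_
    exact cell c' (linePath i' t').symm
  choose w hw using exists_mem_star (K := K)
  -- Lebesgue subdivision: each piece of `γ` stays in one open star.
  obtain ⟨T, hT0, hT, ⟨n, hn⟩, hcov⟩ := exists_monotone_Icc_subset_open_cover_unitInterval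
    (c := fun a : K.carrier => γ ⁻¹' K.star (w a))
    (fun a => (isOpen_star _).preimage γ.continuous)
    (fun s _ => Set.mem_iUnion.2 ⟨γ s, hw (γ s)⟩)
  have main : ∀ m, G (γ.subpath 0 (T m)) := by
    intro m
    induction m with
    | zero =>
      rw [hT0, Path.subpath_self]
      obtain ⟨c, t, -, h⟩ := K.exists_open_cell (γ 0)
      rw [← h]
      exact cell c (Path.refl t)
    | succ m ih =>
      refine homotopic ⟨Path.Homotopy.subpathTransSubpath γ 0 (T m) (T (m + 1))⟩
        (trans _ _ ih ?_)
      obtain ⟨a, ha⟩ := hcov m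
      refine star (w a) _ fun s => ?_
      have hs : γ.subpath (T m) (T (m + 1)) s ∈ Set.range (γ.subpath (T m) (T (m + 1))) :=
        ⟨s, rfl⟩
      rw [Path.range_subpath_of_le _ _ _ (hT m.le_succ)] at hs
      obtain ⟨r, hr, h⟩ := hs
      rw [← h]
      exact ha hr
  have h1 := main n
  rw [hn n le_rfl, Path.subpath_zero_one] at h1
  exact cast _ _ _ h1

end SimplicialCW

/-! ### Lifting paths through a quotient of a simply connected space. -/

theorem Path.cast_refl {X : Type*} [TopologicalSpace X] {x y : X} (h : y = x) :
    (Path.refl x).cast h h = Path.refl y := by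
  subst h
  rfl

/-- A path homotopic to the image of every path over it. -/
def IsLiftable {X Y : Type*} [TopologicalSpace X] [TopologicalSpace Y] (q : C(X, Y)) {x y : Y}
    (γ : Path x y) : Prop :=
  ∀ (a b : X) (ha : x = q a) (hb : y = q b) (σ : Path a b),
    ((σ.map q.continuous).cast ha hb).Homotopic γ

section

variable {X Y : Type*} [TopologicalSpace X] [TopologicalSpace Y] {q : C(X, Y)}

theorem IsLiftable.homotopic {x y : Y} {γ γ' : Path x y} (h : γ.Homotopic γ')
    (hγ : IsLiftable q γ) : IsLiftable q γ' :=
  fun a b ha hb σ => (hγ a b ha hb σ).trans h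

variable [SimplyConnectedSpace X]

/-- A path over the concatenation need not pass over `y`, but in `X` it is homotopic to one that
does. -/
theorem IsLiftable.trans (hq : Function.Surjective q) {x y z : Y} {γ : Path x y} {γ' : Path y z}
    (hγ : IsLiftable q γ) (hγ' : IsLiftable q γ') : IsLiftable q (γ.trans γ') := by
  rintro a c rfl rfl σ
  obtain ⟨b, rfl⟩ := hq y
  let σ₁ : Path a b := PathConnectedSpace.somePath a b
  let σ₂ : Path b c := PathConnectedSpace.somePath b c
  have h : σ.Homotopic (σ₁.trans σ₂) := SimplyConnectedSpace.paths_homotopic _ _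
  refine (h.map q).trans ?_
  rw [Path.map_trans]
  exact (hγ a b rfl rfl σ₁).hcomp (hγ' b c rfl rfl σ₂)

/-- The images of the paths between points of one fibre are null-homotopic. -/
def FiberPathsNull (q : C(X, Y)) : Prop :=
  ∀ (a b : X) (h : q a = q b) (σ : Path a b),
    ((σ.map q.continuous).cast rfl h).Homotopic (Path.refl (q a))

/-- Another path over the same endpoints is homotopic to `σ` preceded and followed by paths in
fibres, whose images are null-homotopic. -/
theorem FiberPathsNull.isLiftable_map (hq : FiberPathsNull q) {a b : X} (σ : Path a b) :
    IsLiftable q (σ.map q.continuous) := by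
  intro a' b' ha hb σ'
  let α : Path a' a := PathConnectedSpace.somePath a' a
  let β : Path b b' := PathConnectedSpace.somePath b b'
  have hα := hq a' a ha.symm α
  have hβ := hq b b' hb β
  have h : σ'.Homotopic (α.trans (σ.trans β)) := SimplyConnectedSpace.paths_homotopic _ _
  have h' : ((σ'.map q.continuous).cast ha hb).Homotopic
      (((α.map q.continuous).cast ha rfl).trans
        ((σ.map q.continuous).trans ((β.map q.continuous).cast rfl hb))) := by
    have := (h.map q).pathCast ha hb
    rw [Path.map_trans, Path.map_trans] at this
    exact this
  refine h'.trans ?_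
  have hα' : ((α.map q.continuous).cast ha rfl).Homotopic (Path.refl (q a)) := by
    have := hα.pathCast ha ha
    rw [Path.cast_refl] at this
    exact this
  refine (hα'.hcomp ((Path.Homotopic.refl _).hcomp hβ)).trans ?_
  exact Path.Homotopic.trans ⟨Path.Homotopy.reflTrans _⟩ ⟨Path.Homotopy.transRefl _⟩

theorem simplyConnectedSpace_of_isLiftable (hq : Function.Surjective q)
    (h : ∀ {x y : Y} (γ : Path x y), IsLiftable q γ) : SimplyConnectedSpace Y := by
  rw [simply_connected_iff_paths_homotopic']
  refine ⟨hq.pathConnectedSpace q.continuous, fun {x y} γ γ' => ?_⟩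
  obtain ⟨a, rfl⟩ := hq x
  obtain ⟨b, rfl⟩ := hq y
  let σ : Path a b := PathConnectedSpace.somePath a b
  exact (h γ a b rfl rfl σ).symm.trans (h γ' a b rfl rfl σ)

/-- If `q` glues along a relation of points `x`, `y` that are joined by a path of the form
`δ · δ'` with `q ∘ δ'` the reverse of `q ∘ δ`, then the images of the paths in the fibres are
null-homotopic. -/
theorem fiberPathsNull_of_eqvGen {r : X → X → Prop}
    (hr : ∀ x y, q x = q y ↔ Relation.EqvGen r x y)
    (h : ∀ x y, r x y → ∃ (z : X) (δ : Path x z) (δ' : Path y z), ∀ s, q (δ s) = q (δ' s)) :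
    FiberPathsNull q := by
  intro a b hab σ
  have hab' := (hr a b).1 hab
  induction hab' with
  | rel x y hxy =>
    obtain ⟨z, δ, δ', hδ⟩ := h x y hxy
    have h1 : σ.Homotopic (δ.trans δ'.symm) := SimplyConnectedSpace.paths_homotopic _ _
    have h2 : ((σ.map q.continuous).cast rfl hab).Homotopic
        ((δ.map q.continuous).trans (δ.map q.continuous).symm) := by
      have h3 := (h1.map q).pathCast rfl hab
      rw [Path.map_trans] at h3
      -- The return path along `δ'` has the same image as the reverse of `δ`.
      have h4 : (δ.map q.continuous).symm = (δ'.symm.map q.continuous).cast rfl hab := by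
        ext s
        exact hδ _
      rw [h4]
      exact h3
    exact h2.trans (Path.Homotopic.symm ⟨Path.Homotopy.reflTransSymm _⟩)
  | refl x => exact (SimplyConnectedSpace.paths_homotopic σ (Path.refl x)).map q
  | symm x y hxy ih =>
    have h1 := (ih hab.symm σ.symm).symm₂
    have h2 := h1.pathCast hab hab
    rw [Path.refl_symm, Path.cast_refl] at h2
    have h3 : (σ.map q.continuous).cast rfl hab =
        ((σ.symm.map q.continuous).cast rfl hab.symm).symm.cast hab hab := by
      ext s
      simp
    rw [h3]
    exact h2
  | trans x y z hxy hyz ih₁ ih₂ =>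
    let σ₁ : Path x y := PathConnectedSpace.somePath x y
    let σ₂ : Path y z := PathConnectedSpace.somePath y z
    have e₁ : q x = q y := (hr x y).2 hxy
    have e₂ : q y = q z := (hr y z).2 hyz
    have h1 : σ.Homotopic (σ₁.trans σ₂) := SimplyConnectedSpace.paths_homotopic _ _
    have h2 := (h1.map q).pathCast rfl hab
    rw [Path.map_trans] at h2
    have h3 := (ih₁ e₁ σ₁).hcomp ((ih₂ e₂ σ₂).pathCast e₁ e₁)
    rw [Path.cast_refl] at h3
    exact Path.Homotopic.trans (h2.trans h3) ⟨Path.Homotopy.transRefl _⟩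

end

/-! ### Gluings and balls. -/

namespace Pseudomanifold

variable {d : ℕ}

/-- Identifying two cells that share a point preserves simple connectedness. -/
theorem IsGluing.simplyConnectedSpace {P Q : Pseudomanifold.{u} d} {a b : P.Cell}
    (h : P.IsGluing a b Q) (hab : (P.closedCell a ∩ P.closedCell b).Nonempty)
    (hP : SimplyConnectedSpace P.carrier) : SimplyConnectedSpace Q.carrier := by
  obtain ⟨g, q, hq, hqr, hcell⟩ := h
  let q' : C(P.carrier, Q.carrier) := ⟨q, hq.continuous⟩
  have hinj : ∀ c, Function.Injective fun t => q (P.χ c t) := by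
    intro c t u htu
    obtain ⟨c', e, he⟩ := hcell c
    simp only [he] at htu
    exact stdSimplex.map_injective e.injective (Q.injective_χ c' htu)
  obtain ⟨v, ⟨t₀, ht₀⟩, ⟨s₀, hs₀⟩⟩ := hab
  have hgl : ∀ t, q (P.χ a t) = q (P.χ b (stdSimplex.map g t)) := fun t =>
    (hqr _ _).2 (Relation.EqvGen.rel _ _ ⟨t, rfl, rfl⟩)
  -- The common point is glued to itself, because `q` is injective on the closed cell `b`.
  have hv : P.χ b (stdSimplex.map g t₀) = P.χ a t₀ := by
    have h1 : q (P.χ b (stdSimplex.map g t₀)) = q (P.χ b s₀) := by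
      rw [← hgl, ht₀, hs₀]
    rw [hinj b h1, hs₀, ht₀]
  have hnull : FiberPathsNull q' := by
    refine fiberPathsNull_of_eqvGen hqr ?_
    rintro x y ⟨t, rfl, rfl⟩
    let τ : Path t t₀ := PathConnectedSpace.somePath t t₀
    refine ⟨P.χ a t₀, τ.map (P.continuous_χ a),
      ((τ.map (stdSimplex.continuous_map g)).map (P.continuous_χ b)).cast rfl hv.symm,
      fun s => hgl (τ s)⟩
  refine simplyConnectedSpace_of_isLiftable (q := q') hq.surjective fun γ => ?_
  refine Q.path_induction (G := fun γ => IsLiftable q' γ) IsLiftable.homotopic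
    (fun _ _ => IsLiftable.trans hq.surjective) ?_ γ
  intro c t u τ
  -- The barycentre is interior to `c`; the open cell of `P` containing a preimage of it maps onto
  -- an open cell of `Q`, which must be that of `c`. Thus `c` lifts to a cell of `P`.
  obtain ⟨p, hp⟩ := hq.surjective (Q.χ c stdSimplex.barycenter)
  obtain ⟨k, r, hr, rfl⟩ := P.exists_open_cell p
  obtain ⟨c', e, he⟩ := hcell k
  obtain rfl : c' = c := by
    refine SimplicialCW.eq_of_open_cell (t := stdSimplex.map e r) (fun i => ?_) (fun i => ?_)
      ((he r).symm.trans hp)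
    · obtain ⟨j, rfl⟩ := e.surjective i
      rw [stdSimplex.map_apply_of_injective e.injective]
      exact hr j
    · change 0 < stdSimplex.barycenter.val i
      rw [stdSimplex.barycenter_apply]
      positivity
  have hinv : ∀ s, q (P.χ k (stdSimplex.map e.symm s)) = Q.χ c' s := by
    intro s
    rw [he, stdSimplex.map_comp_apply, Equiv.self_comp_symm, stdSimplex.map_id_apply]
  let σ := (τ.map (stdSimplex.continuous_map e.symm)).map (P.continuous_χ k)
  have hσ := hnull.isLiftable_map σ
  have : τ.map (Q.continuous_χ c') =
      (σ.map q'.continuous).cast (hinv t).symm (hinv u).symm := by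
    ext s
    exact (hinv (τ s)).symm
  rw [this]
  intro a b ha hb ρ
  exact hσ a b ((hinv t).trans ha) ((hinv u).trans hb) ρ

theorem IsBall.simplyConnectedSpace {P : Pseudomanifold.{u} d} (h : P.IsBall) :
    SimplyConnectedSpace P.carrier := by
  obtain ⟨-, ⟨e⟩⟩ := h
  have : ContractibleSpace (Metric.closedBall (0 : EuclideanSpace ℝ (Fin d)) 1) :=
    (convex_closedBall _ _).contractibleSpace ⟨0, by simp⟩
  have := e.contractibleSpace
  infer_instance

end Pseudomanifold

/-- Every Mogami `d`-pseudomanifold is simply connected. -/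
theorem proposition1p1 (d : ℕ) (hd : 2 ≤ d) (M : Pseudomanifold.{u} d) (hM : M.IsMogami) :
    SimplyConnectedSpace M.carrier := by
  obtain ⟨T, hT, hTM⟩ := hM
  induction hTM with
  | refl => exact hT.1.simplyConnectedSpace
  | tail _ h ih =>
    obtain ⟨a, b, -, -, -, hab, hg⟩ := h
    exact hg.simplyConnectedSpace hab ih
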